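/- **Setting.** Let $\alpha>-\tfrac12$, and let $C_n^{(\alpha)}$ be the Gegenbauer polynomials standardized by $C_0^{(\alpha)}=1$, $C_1^{(\alpha)}(x)=x$ and $(n+2\alpha)C_{n+1}^{(\alpha)}(x)=2(n+\alpha)xC_n^{(\alpha)}(x)-nC_{n-1}^{(\alpha)}(x)$ for $n\ge 1$ (so $C_n^{(\alpha)}(1)=1$). For $L>0$ put $C_{L,n}^{(\alpha)}(x)=C_n^{(\alpha)}(2x/L-1)$ and $\lambda_{L,n}^{(\alpha)}=\int_0^L C_{L,n}^{(\alpha)}(x)^2\,(Lx-x^2)^{\alpha-1/2}\,dx$. Let $x_{L,N,0}^{(\alpha)},\dots,x_{L,N,N}^{(\alpha)}$ be the zeros of $C_{L,N+1}^{(\alpha)}$ (the shifted Gegenbauer–Gauss nodes), with Christoffel numbers $\varpi_{L,N,k}^{(\alpha)}=\Big(\sum_{j=0}^N C_{L,j}^{(\alpha)}(x_{L,N,k}^{(\alpha)})^2/\lambda_{L,j}^{(\alpha)}\Big)^{-1}$. Let $l,\tau>0$ and let $u$ be a classical solution on $[0,l]\times[0,\tau]$ of $$u_{tt}+\beta_1u_t+\beta_2u=u_{xx}+f\quad(0<x<l,\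 0<t<\tau),$$ $$u(x,0)=g_1(x),\quad u_t(x,0)=g_2(x)\ \ (0<x<l),\qquad u(0,t)=h_1(t),\quad u(l,t)=h_2(t)\ \ (0<t\le\tau),$$ with $f$ integrable and $\beta_1,\beta_2$ constants. For $N_x,N_t\ge 0$, $0\le n\le N_x$, $0\le m\le N_t$, the discrete shifted Gegenbauer coefficients of $\phi=u_{xx}$ are $$\tilde\phi_{n,m}=\frac{1}{\lambda_{l,n}^{(\alpha)}\lambda_{\tau,m}^{(\alpha)}}\sum_{s=0}^{N_x}\sum_{k=0}^{N_t}\varpi_{l,N_x,s}^{(\alpha)}\varpi_{\tau,N_t,k}^{(\alpha)}\,u_{xx}\big(x_{l,N_x,s}^{(\alpha)},x_{\tau,N_t,k}^{(\alpha)}\big)\,C_{l,n}^{(\alpha)}\big(x_{l,N_x,s}^{(\alpha)}\big)\,C_{\tau,m}^{(\alpha)}\big(x_{\tau,N_t,k}^{(\alpha)}\big).$$ **Hypotheses.** Let $t^*\in[0,\tau]$ be a time at which $\sup_{0\le x\le l}|u_{xx}(x,t)|$ is maximal over $0\le t\le\tau$. Suppose that $U(x)=u(x,t^*)$ is analytic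 on $[0,l]$ and that there are constants $\rho\ge1$ and $C=C(l,\rho)$ with $$\|U^{(k)}\|_{L^\infty[0,l]}\le C\,\frac{k!}{\rho^k}\qquad\text{for all }k\ge0 .$$ **Bounds.** For all $0\le n\le N_x$ and $0\le m\le N_t$, $|\tilde\phi_{n,m}|$ is at most * if $\alpha\ge0$: $\displaystyle\frac{8\,C\,(n+\alpha)(m+\alpha)\,\Gamma(n+2\alpha)\,\Gamma(m+2\alpha)}{\rho^2\,\Gamma(2\alpha+1)^2\,\Gamma(n+1)\,\Gamma(m+1)}$, where for $\alpha=0$ and $n=0$ the factor $(n+\alpha)\Gamma(n+2\alpha)$ means its limit $\tfrac12$ (and likewise for $m$); * if $-\tfrac12<\alpha<0$ and $n,m$ are even: $\displaystyle\frac{2\,C\,|(n+\alpha)(m+\alpha)|}{(\rho\alpha)^2}\left|\binom{\frac n2+\alpha-1}{\frac n2}\binom{\frac m2+\alpha-1}{\frac m2}\right|$; * if $-\tfrac12<\alpha<0$ and $n,m$ are odd: $\displaystyle\frac{8\,C\,|(n+\alpha)(m+\alpha)|\,\Gamma(\frac{n+1}2+\alpha)\,\Gamma(\frac{m+1}2+\alpha)}{\rho^2\,\Gamma(\alpha+1)^2\,\Gamma(\frac{n+1}2)\,\Gamma(\frac{m+1}2)\,\sqrt[4]{n^2m^2(n+2\alpha)^2(m+2\alpha)^2}}$;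 * if $-\tfrac12<\alpha<0$, $n$ is even and $m$ is odd: $\displaystyle\frac{4\,C\,\Gamma(\frac{m+1}2+\alpha)\,|(n+\alpha)(m+\alpha)|}{(\rho\alpha)^2\sqrt{m(m+2\alpha)}\,\Gamma(\frac{m+1}2)\,|\Gamma(\alpha)|}\left|\binom{\frac n2+\alpha-1}{\frac n2}\right|$; * if $-\tfrac12<\alpha<0$, $n$ is odd and $m$ is even: the same with $n$ and $m$ interchanged. **Asymptotics.** Let $\displaystyle D_1^{(\alpha)}=\frac{\pi^2\,2^{3-4\alpha}\,e^{-4\alpha-2}}{\Gamma(\alpha+\frac12)^2\,\Gamma(\alpha+1)^2}$. There are constants $A_1^{(\alpha)},A_2^{(\alpha)}>1$ and an integer $n_0^{(\alpha)}$, depending only on $\alpha$, such that with $D_2^{(\alpha)}=A_1^{(\alpha)}A_2^{(\alpha)}D_1^{(\alpha)}$, $D_{1,l,\rho}^{(\alpha)}=\frac{2C}{\rho^2}D_1^{(\alpha)}$ and $D_{2,l,\rho}^{(\alpha)}=\frac{2C}{\rho^2}D_2^{(\alpha)}$, for all $n,m\ge n_0^{(\alpha)}$ with $n\le N_x$, $m\le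 N_t$, $$|\tilde\phi_{n,m}|\le\begin{cases}D_{1,l,\rho}^{(\alpha)}\,(nm)^{2\alpha},&\alpha\ge0,\\ D_{2,l,\rho}^{(\alpha)}\,(nm)^{\alpha},&-\frac12<\alpha<0.\end{cases}$$ -/

import Mathlib

noncomputable section

namespace TelegraphGegenbauer

open MeasureTheory

/-- Gegenbauer polynomials with the standardization `C_n(1) = 1`, by the three-term recurrence
`(n + 2α) C_{n+1} = 2 (n + α) x C_n - n C_{n-1}` for `n ≥ 1`. -/
def gegenbauer (α : ℝ) : ℕ → Polynomial ℝ
  | 0 => 1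
  | 1 => Polynomial.X
  | n + 2 =>
      Polynomial.C (1 / ((n : ℝ) + 1 + 2 * α)) *
        (Polynomial.C (2 * ((n : ℝ) + 1 + α)) * Polynomial.X * gegenbauer α (n + 1)
          - Polynomial.C ((n : ℝ) + 1) * gegenbauer α n)

/-- The shifted Gegenbauer polynomial `C_{L,n}(x) = C_n(2x/L - 1)` on `[0, L]`. -/
def shiftedGegenbauer (α L : ℝ) (n : ℕ) : Polynomial ℝ :=
  (gegenbauer α n).comp (Polynomial.C (2 / L) * Polynomial.X - 1)

/-- The weight `w_L(x) = (L x - x²)^(α - 1/2)`. -/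
def shiftedWeight (α L x : ℝ) : ℝ := (L * x - x ^ 2) ^ (α - 1 / 2)

/-- The squared weighted norm `λ_{L,n} = ∫₀ᴸ C_{L,n}(x)² w_L(x) dx`. -/
def shiftedNormSq (α L : ℝ) (n : ℕ) : ℝ :=
  ∫ x in (0 : ℝ)..L, ((shiftedGegenbauer α L n).eval x) ^ 2 * shiftedWeight α L x

/-- The set of the `N + 1` shifted Gegenbauer-Gauss nodes: the zeros of `C_{L,N+1}`. -/
def sggNodes (α L : ℝ) (N : ℕ) : Finset ℝ := (shiftedGegenbauer α L (N + 1)).roots.toFinset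

/-- The Christoffel number of the `(N + 1)`-point rule at a node `x`. -/
def christoffel (α L : ℝ) (N : ℕ) (x : ℝ) : ℝ :=
  (∑ j ∈ Finset.range (N + 1),
    (shiftedNormSq α L j)⁻¹ * ((shiftedGegenbauer α L j).eval x) ^ 2)⁻¹

/-- The discrete bivariate shifted Gegenbauer coefficient of `φ` with index `(n, m)`, computed on
the grid of `(Nx + 1) × (Nt + 1)` shifted Gegenbauer-Gauss nodes. -/
def discreteCoeff (α l τ : ℝ) (Nx Nt : ℕ) (φ : ℝ → ℝ → ℝ) (n m : ℕ) : ℝ :=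
  1 / (shiftedNormSq α l n * shiftedNormSq α τ m) *
    ∑ x ∈ sggNodes α l Nx, ∑ t ∈ sggNodes α τ Nt,
      (christoffel α l Nx x * christoffel α τ Nt t) * φ x t *
        ((shiftedGegenbauer α l n).eval x * (shiftedGegenbauer α τ m).eval t)

/-- `u` is a (classical) solution of the initial-boundary value problem for the telegraph equation
`u_tt + β₁ u_t + β₂ u = u_xx + f` on `(0, l) × (0, τ)`. -/
structure IsTelegraphSolution (l τ β₁ β₂ : ℝ) (f : ℝ → ℝ → ℝ) (g₁ g₂ h₁ h₂ : ℝ → ℝ)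
    (u : ℝ → ℝ → ℝ) : Prop where
  integrable_f :
    IntegrableOn (fun p : ℝ × ℝ => f p.1 p.2) (Set.Ioo 0 l ×ˢ Set.Ioo 0 τ) volume
  continuous_u : ContinuousOn (fun p : ℝ × ℝ => u p.1 p.2) (Set.Icc 0 l ×ˢ Set.Icc 0 τ)
  differentiable_x : ∀ x ∈ Set.Ioo 0 l, ∀ t ∈ Set.Ioo 0 τ,
    DifferentiableAt ℝ (fun y => u y t) x ∧ DifferentiableAt ℝ (deriv fun y => u y t) x
  differentiable_t : ∀ x ∈ Set.Ioo 0 l, ∀ t ∈ Set.Ioo 0 τ,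
    DifferentiableAt ℝ (fun s => u x s) t ∧ DifferentiableAt ℝ (deriv fun s => u x s) t
  pde : ∀ x ∈ Set.Ioo 0 l, ∀ t ∈ Set.Ioo 0 τ,
    deriv (deriv fun s => u x s) t + β₁ * deriv (fun s => u x s) t + β₂ * u x t
      = deriv (deriv fun y => u y t) x + f x t
  initial_value : ∀ x ∈ Set.Ioo 0 l, u x 0 = g₁ x
  initial_velocity : ∀ x ∈ Set.Ioo 0 l,
    HasDerivWithinAt (fun s => u x s) (g₂ x) (Set.Icc 0 τ) 0
  boundary_left : ∀ t ∈ Set.Ioc 0 τ, u 0 t = h₁ t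
  boundary_right : ∀ t ∈ Set.Ioc 0 τ, u l t = h₂ t

/-- `u_xx`, with one-sided derivatives at `x = 0` and `x = l`. -/
def uxx (l : ℝ) (u : ℝ → ℝ → ℝ) (x t : ℝ) : ℝ :=
  iteratedDerivWithin 2 (fun y => u y t) (Set.Icc 0 l) x

/-- At interior points `uxx` is the ordinary second partial derivative. -/
theorem uxx_eq_deriv (l : ℝ) (u : ℝ → ℝ → ℝ) {x : ℝ} (hx : x ∈ Set.Ioo 0 l) (t : ℝ) :
    uxx l u x t = deriv (deriv fun y => u y t) x := by
  have h : ∀ y ∈ Set.Ioo 0 l, derivWithin (fun y => u y t) (Set.Icc 0 l) y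
      = deriv (fun y => u y t) y := fun y hy =>
    derivWithin_of_mem_nhds (Icc_mem_nhds hy.1 hy.2)
  unfold uxx
  rw [iteratedDerivWithin_succ, iteratedDerivWithin_one,
    derivWithin_of_mem_nhds (Icc_mem_nhds hx.1 hx.2)]
  refine Filter.EventuallyEq.deriv_eq ?_
  filter_upwards [isOpen_Ioo.mem_nhds hx] with y hy using h y hy

/-- `tStar` is a time in `[0, τ]` at which the sup norm `‖u_xx(·, t)‖_∞` on `[0, l]` is maximal. -/
def IsArgmaxTime (l τ : ℝ) (u : ℝ → ℝ → ℝ) (tStar : ℝ) : Prop :=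
  tStar ∈ Set.Icc 0 τ ∧
    IsMaxOn (fun t => ⨆ x ∈ Set.Icc 0 l, ‖uxx l u x t‖ₑ) (Set.Icc 0 τ) tStar

/-- The factor `(n + α) Γ(n + 2α)`, understood as its limit `1/2` for `n = 0`, `α = 0`. -/
def gammaFactor (α : ℝ) (n : ℕ) : ℝ :=
  if n = 0 ∧ α = 0 then 1 / 2 else ((n : ℝ) + α) * Real.Gamma ((n : ℝ) + 2 * α)

/-- For even `n`: the absolute value of the binomial coefficient `(n/2 + α - 1 choose n/2)`. -/
def absHalfChoose (α : ℝ) (n : ℕ) : ℝ := |Ring.choose ((n : ℝ) / 2 + α - 1) (n / 2)|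

/-- The constant `D₁^{(α)}`. -/
def D₁ (α : ℝ) : ℝ :=
  Real.pi ^ 2 * (2 : ℝ) ^ (3 - 4 * α) * Real.exp (-4 * α - 2) /
    (Real.Gamma (α + 1 / 2) ^ 2 * Real.Gamma (α + 1) ^ 2)

end TelegraphGegenbauer

end

open TelegraphGegenbauer

namespace TelegraphGegenbauer

open Polynomial

/-! The grid nodes lie in `[0, l] × [0, τ]`, where `|u_xx|` is at most `2C/ρ²`: this is the
derivative bound with `k = 2` at `tStar`, carried to every `t` by maximality. The double sum then
factors, and `|φ̃_{n,m}|` is at most `2C/ρ²` times a product of two one-dimensional quantities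
`λ_n⁻¹ ∑ ϖ |C_n|` (`discreteL1`).

With `r_n = λ_0/λ_n` (`normRatio`), two estimates of `discreteL1` suffice. Both rest on `∑ ϖ C_n² ≤
λ_n` for `n ≤ N`, which needs no exactness of the quadrature: by Christoffel-Darboux, the vectors of
values `C_j(x)` at distinct nodes are orthogonal, and the estimate is Bessel's inequality.
Cauchy-Schwarz against the case `n = 0` gives `discreteL1 ≤ √r_n`; pulling out the maximum of
`|C_n|` gives `discreteL1 ≤ r_n max |C_n|`.

For `α ≥ 0` one has `r_n ≥ 1`, so `√r_n ≤ r_n`, which is the stated Gamma quotient. For `α < 0`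
Sonin's argument bounds the maximum by data at the origin, which are explicit. The asymptotics
follow from `√r_n = O(n^α)`, a consequence of Euler's limit for `Γ(2α+1)`. -/

/-! ### Gegenbauer polynomials: recurrence, zeros, differential equation, Sonin's bound -/

theorem gegenbauer_zero (α : ℝ) : gegenbauer α 0 = 1 := by rw [gegenbauer]

theorem gegenbauer_one (α : ℝ) : gegenbauer α 1 = X := by rw [gegenbauer]

theorem index_add_pos {α : ℝ} (hα : -1 / 2 < α) (n : ℕ) : 0 < (n : ℝ) + 1 + 2 * α := by
  have : (0 : ℝ) ≤ n := n.cast_nonneg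
  linarith

theorem index_pos {α : ℝ} (hα : -1 / 2 < α) (n : ℕ) : 0 < (n : ℝ) + 1 + α := by
  have : (0 : ℝ) ≤ n := n.cast_nonneg
  linarith

theorem gegenbauer_recurrence {α : ℝ} (hα : -1 / 2 < α) (n : ℕ) :
    C ((n : ℝ) + 1 + 2 * α) * gegenbauer α (n + 2) =
      C (2 * ((n : ℝ) + 1 + α)) * X * gegenbauer α (n + 1)
        - C ((n : ℝ) + 1) * gegenbauer α n := by
  rw [gegenbauer, ← mul_assoc, ← C_mul, mul_one_div_cancel (index_add_pos hα n).ne', C_1, one_mul]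

theorem gegenbauer_eval_recurrence {α : ℝ} (hα : -1 / 2 < α) (n : ℕ) (x : ℝ) :
    ((n : ℝ) + 1 + 2 * α) * (gegenbauer α (n + 2)).eval x =
      2 * ((n : ℝ) + 1 + α) * x * (gegenbauer α (n + 1)).eval x
        - ((n : ℝ) + 1) * (gegenbauer α n).eval x := by
  simpa using congrArg (eval x) (gegenbauer_recurrence hα n)

theorem gegenbauer_eval_neg {α : ℝ} (hα : -1 / 2 < α) (x : ℝ) (n : ℕ) :
    (gegenbauer α n).eval (-x) = (-1) ^ n * (gegenbauer α n).eval x := by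
  induction n using Nat.twoStepInduction with
  | zero => simp [gegenbauer_zero]
  | one => simp [gegenbauer_one]
  | more n h0 h1 =>
    refine mul_left_cancel₀ (index_add_pos hα n).ne' ?_
    rw [gegenbauer_eval_recurrence hα, h0, h1]
    linear_combination (-(-1 : ℝ) ^ n) * gegenbauer_eval_recurrence hα n x

/-- The recurrence rearranges to `(n+1+2α)(C_{n+2} - C_{n+1}) = 2(n+1+α)(x-1)C_{n+1} + (n+1)(C_{n+1}
- C_n)`, whose right side is nonnegative by induction. With parity this confines the zeros to `(-1,
1)`. -/
theorem one_le_gegenbauer_eval {α : ℝ} (hα : -1 / 2 < α) {x : ℝ} (hx : 1 ≤ x) (n : ℕ) :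
    1 ≤ (gegenbauer α n).eval x ∧ (gegenbauer α n).eval x ≤ (gegenbauer α (n + 1)).eval x := by
  induction n with
  | zero => simpa [gegenbauer_zero, gegenbauer_one] using hx
  | succ n ih =>
    refine ⟨ih.1.trans ih.2, ?_⟩
    have hrec := gegenbauer_eval_recurrence hα n x
    have h1 := index_add_pos hα n
    have h2 := index_pos hα n
    have hn : (0 : ℝ) ≤ n := n.cast_nonneg
    have h3 : 0 ≤ (x - 1) * (gegenbauer α (n + 1)).eval x :=
      mul_nonneg (by linarith) (by linarith [ih.1, ih.2])
    have h4 : 0 ≤ ((n : ℝ) + 1) *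
        ((gegenbauer α (n + 1)).eval x - (gegenbauer α n).eval x) :=
      mul_nonneg (by linarith) (by linarith [ih.2])
    refine le_of_mul_le_mul_left ?_ h1
    rw [hrec]
    linarith [mul_nonneg h2.le h3]

theorem abs_lt_one_of_gegenbauer_eval_eq_zero {α : ℝ} (hα : -1 / 2 < α) {n : ℕ} {x : ℝ}
    (hx : (gegenbauer α n).eval x = 0) : |x| < 1 := by
  by_contra! h
  rcases le_abs'.1 h with h | h
  · have := (one_le_gegenbauer_eval hα (le_neg.2 h) n).1
    rw [gegenbauer_eval_neg hα, hx, mul_zero] at this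
    linarith
  · have := (one_le_gegenbauer_eval hα h n).1
    rw [hx] at this
    linarith

/-- The two identities are proved together because the differentiated recurrence expresses
`C_{n+2}'` through both `C_{n+1}'` and `C_n'`. -/
theorem one_sub_sq_mul_derivative_gegenbauer {α : ℝ} (hα : -1 / 2 < α) (n : ℕ) :
    (1 - X ^ 2) * derivative (gegenbauer α (n + 1)) =
        C ((n : ℝ) + 1) * (gegenbauer α n - X * gegenbauer α (n + 1)) ∧
      (1 - X ^ 2) * derivative (gegenbauer α n) =
        C ((n : ℝ) + 2 * α) * (X * gegenbauer α n - gegenbauer α (n + 1)) := by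
  induction n with
  | zero => simp [gegenbauer_zero, gegenbauer_one, sq]
  | succ n ih =>
    have hne : (C ((n : ℝ) + 1 + 2 * α) : ℝ[X]) ≠ 0 := C_ne_zero.2 (index_add_pos hα n).ne'
    have hrec := gegenbauer_recurrence hα n
    have hder := congrArg derivative hrec
    simp only [derivative_mul, derivative_sub, derivative_C, derivative_X, zero_mul, zero_add,
      mul_one] at hder
    refine ⟨mul_left_cancel₀ hne ?_, ?_⟩
    · push_cast [C_add, C_mul, C_ofNat, C_1] at hder hrec ih ⊢
      linear_combination (1 - X ^ 2) * hder + 2 * (C (n : ℝ) + 1 + C α) * X * ih.1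
        - (C (n : ℝ) + 1) * ih.2 + (C (n : ℝ) + 2) * X * hrec
    · push_cast [C_add, C_mul, C_ofNat, C_1] at hrec ih ⊢
      linear_combination ih.1 + hrec

/-- Differentiating the first structure relation and eliminating the lower-index polynomial with
both relations gives the equation times `1 - X²`, a nonzero factor that cancels in `ℝ[X]`. -/
theorem gegenbauer_ode {α : ℝ} (hα : -1 / 2 < α) (n : ℕ) :
    (1 - X ^ 2) * derivative (derivative (gegenbauer α n)) =
      C (2 * α + 1) * X * derivative (gegenbauer α n)
        - C ((n : ℝ) * (n + 2 * α)) * gegenbauer α n := by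
  cases n with
  | zero => simp [gegenbauer_zero]
  | succ n =>
    obtain ⟨h1, h2⟩ := one_sub_sq_mul_derivative_gegenbauer hα n
    have hder := congrArg derivative h1
    have hne : (1 - X ^ 2 : ℝ[X]) ≠ 0 := fun h => by simpa using congrArg (eval 0) h
    refine mul_left_cancel₀ hne ?_
    simp only [derivative_mul, derivative_sub, derivative_C, derivative_X, derivative_one,
      derivative_X_pow, zero_mul, zero_add] at hder
    push_cast [C_add, C_mul, C_ofNat, C_1] at hder h1 h2 ⊢
    linear_combination (1 - X ^ 2) * hder + (C (n : ℝ) + 1) * h2 +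
      (1 - 2 * C α - (C (n : ℝ) + 1)) * X * h1

/-- Sonin's argument: for `α ≤ 0` the function `n (n + 2α) C_n² + (1 - x²) (C_n')²` is largest
at the origin. -/
theorem gegenbauer_sonin {α : ℝ} (hα : -1 / 2 < α) (hα0 : α ≤ 0) (n : ℕ) {x : ℝ} (hx : |x| ≤ 1) :
    (n : ℝ) * (n + 2 * α) * (gegenbauer α n).eval x ^ 2 ≤
      (n : ℝ) * (n + 2 * α) * (gegenbauer α n).eval 0 ^ 2 +
        (derivative (gegenbauer α n)).eval 0 ^ 2 := by
  set P := gegenbauer α n with hP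
  set F : ℝ[X] := C ((n : ℝ) * (n + 2 * α)) * P ^ 2 + (1 - X ^ 2) * derivative P ^ 2 with hF
  -- The differential equation cancels the `P P'` terms; for `α ≤ 0` what remains has the sign of
  -- `-x`, so `F` increases up to `0` and decreases after it.
  have hF' : derivative F = C (4 * α) * X * derivative P ^ 2 := by
    have hode := gegenbauer_ode hα n
    rw [← hP] at hode
    simp only [hF, derivative_mul, derivative_add, derivative_sub, derivative_C, derivative_one,
      derivative_pow, derivative_X, Nat.cast_ofNat, C_ofNat, Nat.add_one_sub_one, pow_one,
      zero_mul, zero_add, mul_one, zero_sub]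
    simp only [C_add, C_mul, C_ofNat, C_1] at hode ⊢
    linear_combination 2 * derivative P * hode
  have hFx : ∀ y, F.eval y = (n : ℝ) * (n + 2 * α) * P.eval y ^ 2 +
      (1 - y ^ 2) * (derivative P).eval y ^ 2 := fun y => by simp [hF]
  have hd : ∀ y, deriv (fun z => F.eval z) y = 4 * α * y * (derivative P).eval y ^ 2 := fun y => by
    rw [Polynomial.deriv, hF']; simp
  have key : F.eval x ≤ F.eval 0 := by
    rcases le_total 0 x with h | h
    · refine antitoneOn_of_deriv_nonpos (convex_Ici 0) F.continuous.continuousOn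
        F.differentiable.differentiableOn (fun y hy => ?_) Set.self_mem_Ici h h
      rw [interior_Ici] at hy
      rw [hd]
      exact mul_nonpos_of_nonpos_of_nonneg
        (mul_nonpos_of_nonpos_of_nonneg (by linarith) (le_of_lt hy)) (sq_nonneg _)
    · refine monotoneOn_of_deriv_nonneg (convex_Iic 0) F.continuous.continuousOn
        F.differentiable.differentiableOn (fun y hy => ?_) h Set.self_mem_Iic h
      rw [interior_Iic] at hy
      rw [hd]
      exact mul_nonneg (mul_nonneg_of_nonpos_of_nonpos (by linarith) (le_of_lt hy)) (sq_nonneg _)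
  rw [hFx, hFx] at key
  have hx2 : x ^ 2 ≤ 1 := (sq_le_one_iff_abs_le_one x).2 hx
  have := mul_nonneg (sub_nonneg.2 hx2) (sq_nonneg ((derivative P).eval x))
  linarith

/-! ### Integration against the weight and orthogonality -/

theorem intervalIntegrable_shiftedWeight {α L : ℝ} (hα : -1 / 2 < α) (hL : 0 < L) :
    IntervalIntegrable (shiftedWeight α L) MeasureTheory.volume 0 L := by
  have half : IntervalIntegrable (shiftedWeight α L) MeasureTheory.volume 0 (L / 2) := by
    have h1 : IntervalIntegrable (fun x : ℝ => x ^ (α - 1 / 2)) MeasureTheory.volume 0 (L / 2) :=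
      intervalIntegral.intervalIntegrable_rpow' (by linarith)
    have h2 : ContinuousOn (fun x : ℝ => (L - x) ^ (α - 1 / 2)) (Set.uIcc 0 (L / 2)) := by
      refine ContinuousOn.rpow_const (by fun_prop) fun x hx => Or.inl ?_
      rw [Set.uIcc_of_le (by linarith)] at hx
      linarith [hx.2]
    refine (h1.mul_continuousOn h2).congr fun x hx => ?_
    rw [Set.uIoc_of_le (by linarith)] at hx
    simp only [shiftedWeight]
    rw [← Real.mul_rpow hx.1.le (by linarith [hx.2])]
    ring_nf
  -- The weight is invariant under `x ↦ L - x`, so integrability near `L` follows from that near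
  -- `0`.
  have h := half.symm.comp_sub_left L
  refine half.trans (b := L / 2) ?_
  have e1 : L - L / 2 = L / 2 := by ring
  rw [e1, sub_zero] at h
  refine h.congr fun x _ => ?_
  simp only [shiftedWeight]
  ring_nf

/-- The integral of `Q (2x/L - 1)` against the weight on `[0, L]`. -/
noncomputable def weightedIntegral (α L : ℝ) (Q : ℝ[X]) : ℝ :=
  ∫ x in (0 : ℝ)..L, Q.eval (2 / L * x - 1) * shiftedWeight α L x

theorem intervalIntegrable_eval_mul_weight {α L : ℝ} (hα : -1 / 2 < α) (hL : 0 < L) (Q : ℝ[X]) :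
    IntervalIntegrable (fun x => Q.eval (2 / L * x - 1) * shiftedWeight α L x)
      MeasureTheory.volume 0 L :=
  (intervalIntegrable_shiftedWeight hα hL).continuousOn_mul
    (Q.continuous.comp (by fun_prop)).continuousOn

theorem weightedIntegral_sub {α L : ℝ} (hα : -1 / 2 < α) (hL : 0 < L) (P Q : ℝ[X]) :
    weightedIntegral α L (P - Q) = weightedIntegral α L P - weightedIntegral α L Q := by
  simp only [weightedIntegral, eval_sub, sub_mul]
  exact intervalIntegral.integral_sub (intervalIntegrable_eval_mul_weight hα hL P)
    (intervalIntegrable_eval_mul_weight hα hL Q)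

theorem weightedIntegral_C_mul (α L c : ℝ) (Q : ℝ[X]) :
    weightedIntegral α L (C c * Q) = c * weightedIntegral α L Q := by
  simp only [weightedIntegral, eval_mul, eval_C, mul_assoc]
  exact intervalIntegral.integral_const_mul _ _

theorem weightedIntegral_one_pos {α L : ℝ} (hα : -1 / 2 < α) (hL : 0 < L) :
    0 < weightedIntegral α L 1 := by
  refine intervalIntegral.intervalIntegral_pos_of_pos_on
    (intervalIntegrable_eval_mul_weight hα hL 1) (fun x hx => ?_) hL
  rw [eval_one, one_mul]
  exact Real.rpow_pos_of_pos (by nlinarith [mul_pos hx.1 (sub_pos.2 hx.2)]) _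

/-- Up to the factor `L/2`, the integrand is the derivative of `(Lx - x²)^(α+1/2) Q(2x/L - 1)`,
which vanishes at both ends because `α + 1/2 > 0`. -/
theorem weightedIntegral_by_parts {α L : ℝ} (hα : -1 / 2 < α) (hL : 0 < L) (Q : ℝ[X]) :
    weightedIntegral α L ((1 - X ^ 2) * derivative Q - C (2 * α + 1) * X * Q) = 0 := by
  have hint := (intervalIntegrable_eval_mul_weight hα hL
    ((1 - X ^ 2) * derivative Q - C (2 * α + 1) * X * Q)).const_mul (L / 2)
  have key := intervalIntegral.integral_eq_sub_of_hasDerivAt_of_le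
    (f := fun x => (L * x - x ^ 2) ^ (α + 1 / 2) * Q.eval (2 / L * x - 1)) hL.le
    (ContinuousOn.mul (ContinuousOn.rpow_const (by fun_prop) fun x _ => Or.inr (by linarith))
      (Q.continuous.comp (by fun_prop)).continuousOn) (fun x hx => ?_) hint
  · rw [intervalIntegral.integral_const_mul] at key
    have h0 : (0 : ℝ) ^ (α + 1 / 2) = 0 := Real.zero_rpow (by linarith)
    have h1 : L * L - L ^ 2 = 0 := by ring
    simp only [h1, mul_zero, ne_eq, OfNat.ofNat_ne_zero, not_false_eq_true, zero_pow, sub_zero,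
      h0, zero_mul] at key
    exact (mul_eq_zero.1 key).resolve_left (by positivity)
  · have hpos : 0 < L * x - x ^ 2 := by nlinarith [mul_pos hx.1 (sub_pos.2 hx.2)]
    have d1 : HasDerivAt (fun x : ℝ => L * x - x ^ 2) (L - 2 * x) x := by
      refine (((hasDerivAt_id x).const_mul L).fun_sub (hasDerivAt_pow 2 x)).congr_deriv ?_
      simp
    have d2 : HasDerivAt (fun x : ℝ => Q.eval (2 / L * x - 1))
        ((derivative Q).eval (2 / L * x - 1) * (2 / L)) x := by
      have : HasDerivAt (fun x : ℝ => 2 / L * x - 1) (2 / L) x := by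
        simpa using ((hasDerivAt_id x).const_mul (2 / L)).sub_const 1
      exact (Q.hasDerivAt _).comp x this
    refine ((d1.rpow_const (p := α + 1 / 2) (Or.inl hpos.ne')).mul d2).congr_deriv ?_
    have e1 : α + 1 / 2 - 1 = α - 1 / 2 := by ring
    have e2 : (L * x - x ^ 2) ^ (α + 1 / 2) = (L * x - x ^ 2) * (L * x - x ^ 2) ^ (α - 1 / 2) := by
      rw [← Real.rpow_one_add' hpos.le (by linarith)]
      ring_nf
    simp only [shiftedWeight, e1, e2, eval_sub, eval_mul, eval_one, eval_pow, eval_X, eval_C]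
    field_simp
    ring

theorem weightedIntegral_gegenbauer_mul {α L : ℝ} (hα : -1 / 2 < α) (hL : 0 < L) (n m : ℕ) :
    (n : ℝ) * (n + 2 * α) * weightedIntegral α L (gegenbauer α n * gegenbauer α m) =
      weightedIntegral α L ((1 - X ^ 2) *
        (derivative (gegenbauer α n) * derivative (gegenbauer α m))) := by
  have h := weightedIntegral_by_parts hα hL (derivative (gegenbauer α n) * gegenbauer α m)
  have e : (1 - X ^ 2) * derivative (derivative (gegenbauer α n) * gegenbauer α m) -
      C (2 * α + 1) * X * (derivative (gegenbauer α n) * gegenbauer α m) =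
      (1 - X ^ 2) * (derivative (gegenbauer α n) * derivative (gegenbauer α m)) -
        C ((n : ℝ) * (n + 2 * α)) * (gegenbauer α n * gegenbauer α m) := by
    rw [derivative_mul]
    linear_combination gegenbauer α m * gegenbauer_ode hα n
  rw [e, weightedIntegral_sub hα hL, weightedIntegral_C_mul] at h
  linarith

/-- The Dirichlet form in `weightedIntegral_gegenbauer_mul` is symmetric in `n` and `m`, while the
eigenvalues differ by `(m - n)(m + n + 2α) > 0`. -/
theorem weightedIntegral_gegenbauer_eq_zero {α L : ℝ} (hα : -1 / 2 < α) (hL : 0 < L) {n m : ℕ}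
    (hnm : n < m) : weightedIntegral α L (gegenbauer α n * gegenbauer α m) = 0 := by
  have h1 := weightedIntegral_gegenbauer_mul hα hL n m
  have h2 := weightedIntegral_gegenbauer_mul hα hL m n
  rw [mul_comm (gegenbauer α m), mul_comm (derivative (gegenbauer α m))] at h2
  have h3 : ((m : ℝ) - n) * (m + n + 2 * α) *
      weightedIntegral α L (gegenbauer α n * gegenbauer α m) = 0 := by linear_combination h2 - h1
  have h4 : (n : ℝ) + 1 ≤ m := by exact_mod_cast hnm
  have h5 : (0 : ℝ) ≤ n := n.cast_nonneg
  exact (mul_eq_zero.1 h3).resolve_left (mul_pos (by linarith) (by linarith)).ne'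

/-! ### Squared norms and their ratios -/

theorem shiftedGegenbauer_eval (α L : ℝ) (n : ℕ) (x : ℝ) :
    (shiftedGegenbauer α L n).eval x = (gegenbauer α n).eval (2 / L * x - 1) := by
  simp [shiftedGegenbauer]

theorem shiftedNormSq_eq (α L : ℝ) (n : ℕ) :
    shiftedNormSq α L n = weightedIntegral α L (gegenbauer α n * gegenbauer α n) := by
  simp only [shiftedNormSq, weightedIntegral, shiftedGegenbauer_eval, eval_mul, sq]

theorem shiftedNormSq_zero_pos {α L : ℝ} (hα : -1 / 2 < α) (hL : 0 < L) :
    0 < shiftedNormSq α L 0 := by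
  simpa [shiftedNormSq_eq, gegenbauer_zero] using weightedIntegral_one_pos hα hL

theorem weightedIntegral_X_mul {α L : ℝ} (hα : -1 / 2 < α) (hL : 0 < L) (n : ℕ) :
    2 * ((n : ℝ) + 1 + α) * weightedIntegral α L (X * gegenbauer α n * gegenbauer α (n + 1)) =
      ((n : ℝ) + 1) * shiftedNormSq α L n := by
  have h0 : weightedIntegral α L (gegenbauer α n * gegenbauer α (n + 2)) = 0 :=
    weightedIntegral_gegenbauer_eq_zero hα hL (by omega)
  have e : C ((n : ℝ) + 1 + 2 * α) * (gegenbauer α n * gegenbauer α (n + 2)) =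
      C (2 * ((n : ℝ) + 1 + α)) * (X * gegenbauer α n * gegenbauer α (n + 1)) -
        C ((n : ℝ) + 1) * (gegenbauer α n * gegenbauer α n) := by
    linear_combination gegenbauer α n * gegenbauer_recurrence hα n
  have h := congrArg (weightedIntegral α L) e
  rw [weightedIntegral_sub hα hL, weightedIntegral_C_mul, weightedIntegral_C_mul,
    weightedIntegral_C_mul, h0, ← shiftedNormSq_eq] at h
  linarith

theorem shiftedNormSq_one {α L : ℝ} (hα : -1 / 2 < α) (hL : 0 < L) :
    2 * (1 + α) * shiftedNormSq α L 1 = shiftedNormSq α L 0 := by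
  have h := weightedIntegral_X_mul hα hL 0
  simpa [shiftedNormSq_eq, gegenbauer_zero, gegenbauer_one] using h

/-- The integral of `x C_{n+1} C_{n+2}` is computed twice: from the recurrence for `C_{n+2}` tested
against `C_{n+2}`, and from the next recurrence tested against `C_{n+1}`. -/
theorem shiftedNormSq_succ {α L : ℝ} (hα : -1 / 2 < α) (hL : 0 < L) (n : ℕ) :
    ((n : ℝ) + 2 + α) * (n + 1 + 2 * α) * shiftedNormSq α L (n + 2) =
      ((n : ℝ) + 2) * (n + 1 + α) * shiftedNormSq α L (n + 1) := by
  have h0 : weightedIntegral α L (gegenbauer α n * gegenbauer α (n + 2)) = 0 :=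
    weightedIntegral_gegenbauer_eq_zero hα hL (by omega)
  have hX := weightedIntegral_X_mul hα hL (n + 1)
  have e : C ((n : ℝ) + 1 + 2 * α) * (gegenbauer α (n + 2) * gegenbauer α (n + 2)) =
      C (2 * ((n : ℝ) + 1 + α)) * (X * gegenbauer α (n + 1) * gegenbauer α (n + 2)) -
        C ((n : ℝ) + 1) * (gegenbauer α n * gegenbauer α (n + 2)) := by
    linear_combination gegenbauer α (n + 2) * gegenbauer_recurrence hα n
  have h := congrArg (weightedIntegral α L) e
  rw [weightedIntegral_sub hα hL, weightedIntegral_C_mul, weightedIntegral_C_mul,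
    weightedIntegral_C_mul, h0, ← shiftedNormSq_eq] at h
  push_cast at hX
  linear_combination ((n : ℝ) + 2 + α) * h + ((n : ℝ) + 1 + α) * hX

/-- The ratio `λ_{L,0} / λ_{L,n}` of squared norms, which does not depend on `L`. -/
noncomputable def normRatio (α : ℝ) (n : ℕ) : ℝ :=
  2 * gammaFactor α n / (Real.Gamma (2 * α + 1) * Real.Gamma ((n : ℝ) + 1))

theorem normRatio_zero {α : ℝ} (hα : -1 / 2 < α) : normRatio α 0 = 1 := by
  have hG : Real.Gamma (2 * α + 1) ≠ 0 := (Real.Gamma_pos_of_pos (by linarith)).ne'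
  by_cases h : α = 0
  · simp [normRatio, gammaFactor, h]
  · rw [normRatio, gammaFactor, if_neg (by simp [h]), Real.Gamma_add_one (by simpa using h)] at *
    have : Real.Gamma (2 * α) ≠ 0 := (mul_ne_zero_iff.1 hG).2
    simp only [CharP.cast_eq_zero, zero_add, Real.Gamma_one, mul_one]
    field_simp

theorem normRatio_succ_eq (α : ℝ) (n : ℕ) : normRatio α (n + 1) =
    2 * (((n : ℝ) + 1 + α) * Real.Gamma ((n : ℝ) + 1 + 2 * α)) /
      (Real.Gamma (2 * α + 1) * Real.Gamma ((n : ℝ) + 2)) := by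
  rw [normRatio, gammaFactor, if_neg (by simp)]
  push_cast
  ring_nf

theorem normRatio_one {α : ℝ} (hα : -1 / 2 < α) : normRatio α 1 = 2 * (1 + α) := by
  have hG : Real.Gamma (1 + 2 * α) ≠ 0 := (Real.Gamma_pos_of_pos (by linarith)).ne'
  have h := normRatio_succ_eq α 0
  rw [add_comm (2 * α)] at h
  simp only [zero_add, CharP.cast_eq_zero, Real.Gamma_two, mul_one] at h
  rw [h]
  field_simp

theorem normRatio_succ {α : ℝ} (hα : -1 / 2 < α) (n : ℕ) :
    ((n : ℝ) + 2) * (n + 1 + α) * normRatio α (n + 2) =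
      ((n : ℝ) + 2 + α) * (n + 1 + 2 * α) * normRatio α (n + 1) := by
  have hG : Real.Gamma (2 * α + 1) ≠ 0 := (Real.Gamma_pos_of_pos (by linarith)).ne'
  have h1 := index_add_pos hα n
  have hn : (0 : ℝ) ≤ n := n.cast_nonneg
  have hF : Real.Gamma ((n : ℝ) + 2) ≠ 0 := (Real.Gamma_pos_of_pos (by linarith)).ne'
  have g1 : Real.Gamma ((n : ℝ) + 1 + 1 + 2 * α) =
      ((n : ℝ) + 1 + 2 * α) * Real.Gamma ((n : ℝ) + 1 + 2 * α) := by
    rw [← Real.Gamma_add_one h1.ne']; ring_nf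
  have g2 : Real.Gamma ((n : ℝ) + 1 + 2) = ((n : ℝ) + 2) * Real.Gamma ((n : ℝ) + 2) := by
    rw [← Real.Gamma_add_one (by positivity)]; ring_nf
  rw [normRatio_succ_eq α (n + 1), normRatio_succ_eq]
  push_cast
  rw [g1, g2]
  field_simp
  ring

theorem normRatio_pos {α : ℝ} (hα : -1 / 2 < α) (n : ℕ) : 0 < normRatio α n := by
  cases n with
  | zero => rw [normRatio_zero hα]; exact one_pos
  | succ n =>
    have hn : (0 : ℝ) ≤ n := n.cast_nonneg
    have h1 := Real.Gamma_pos_of_pos (show 0 < 2 * α + 1 by linarith)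
    have h2 := Real.Gamma_pos_of_pos (index_add_pos hα n)
    have h3 := Real.Gamma_pos_of_pos (show (0 : ℝ) < n + 2 by linarith)
    have h4 := index_pos hα n
    rw [normRatio_succ_eq]
    positivity

theorem one_le_normRatio {α : ℝ} (hα : 0 ≤ α) (n : ℕ) : 1 ≤ normRatio α n := by
  have hα' : -1 / 2 < α := by linarith
  induction n using Nat.twoStepInduction with
  | zero => rw [normRatio_zero hα']
  | one => rw [normRatio_one hα']; linarith
  | more n _ ih =>
    have hn : (0 : ℝ) ≤ n := n.cast_nonneg
    have hpos : 0 < ((n : ℝ) + 2) * (n + 1 + α) := by positivity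
    refine le_of_mul_le_mul_left ?_ hpos
    rw [normRatio_succ hα']
    have h : ((n : ℝ) + 2) * (n + 1 + α) ≤ ((n : ℝ) + 2 + α) * (n + 1 + 2 * α) := by
      nlinarith [mul_nonneg hn hα, mul_nonneg hα hα]
    calc ((n : ℝ) + 2) * (n + 1 + α) * 1 ≤ ((n : ℝ) + 2 + α) * (n + 1 + 2 * α) * 1 := by gcongr
      _ ≤ _ := by gcongr

/-- The norms and the Gamma quotients satisfy reciprocal two-term recurrences with matching initial
values. -/
theorem shiftedNormSq_mul_normRatio {α L : ℝ} (hα : -1 / 2 < α) (hL : 0 < L) (n : ℕ) :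
    shiftedNormSq α L n * normRatio α n = shiftedNormSq α L 0 := by
  induction n using Nat.twoStepInduction with
  | zero => rw [normRatio_zero hα, mul_one]
  | one => rw [normRatio_one hα, mul_comm, shiftedNormSq_one hα hL]
  | more n _ ih =>
    have hn : (0 : ℝ) ≤ n := n.cast_nonneg
    have h1 := index_add_pos hα n
    have h2 := index_pos hα n
    have h3 : 0 < (n : ℝ) + 2 + α := by linarith
    have hne : ((n : ℝ) + 2) * (n + 1 + α) * (((n : ℝ) + 2 + α) * (n + 1 + 2 * α)) ≠ 0 := by
      positivity
    refine mul_left_cancel₀ hne ?_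
    rw [← ih]
    linear_combination ((n : ℝ) + 2) * (n + 1 + α) * normRatio α (n + 2) *
        shiftedNormSq_succ hα hL n +
      ((n : ℝ) + 2) * (n + 1 + α) * shiftedNormSq α L (n + 1) * normRatio_succ hα n

theorem shiftedNormSq_inv {α L : ℝ} (hα : -1 / 2 < α) (hL : 0 < L) (n : ℕ) :
    (shiftedNormSq α L n)⁻¹ = (shiftedNormSq α L 0)⁻¹ * normRatio α n := by
  have h := normRatio_pos hα n
  rw [← shiftedNormSq_mul_normRatio hα hL n]
  field_simp

theorem shiftedNormSq_pos {α L : ℝ} (hα : -1 / 2 < α) (hL : 0 < L) (n : ℕ) :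
    0 < shiftedNormSq α L n := by
  rw [← inv_pos, shiftedNormSq_inv hα hL]
  exact mul_pos (inv_pos.2 (shiftedNormSq_zero_pos hα hL)) (normRatio_pos hα n)

/-! ### Christoffel-Darboux and Bessel's inequality -/

/-- The Christoffel-Darboux formula. -/
theorem christoffel_darboux {α : ℝ} (hα : -1 / 2 < α) (x y : ℝ) (N : ℕ) :
    (x - y) * ∑ j ∈ Finset.range (N + 1),
        normRatio α j * ((gegenbauer α j).eval x * (gegenbauer α j).eval y) =
      normRatio α (N + 1) * (((N : ℝ) + 1) / (2 * (N + 1 + α))) *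
        ((gegenbauer α (N + 1)).eval x * (gegenbauer α N).eval y
          - (gegenbauer α N).eval x * (gegenbauer α (N + 1)).eval y) := by
  induction N with
  | zero =>
    have h2 : 1 + α ≠ 0 := by linarith
    simp only [gegenbauer_zero, gegenbauer_one, normRatio_zero hα, normRatio_one hα, zero_add,
      Finset.sum_range_one, CharP.cast_eq_zero, eval_one, eval_X]
    field_simp
  | succ N ih =>
    rw [Finset.sum_range_succ, mul_add, ih]
    have h1 := index_pos hα N
    have h2 : 0 < (N : ℝ) + 1 + 1 + α := by linarith
    have hs : normRatio α (N + 2) * (((N : ℝ) + 2) * (N + 1 + α)) =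
        ((N : ℝ) + 2 + α) * (N + 1 + 2 * α) * normRatio α (N + 1) := by
      rw [← normRatio_succ hα]; ring
    have hx := gegenbauer_eval_recurrence hα N x
    have hy := gegenbauer_eval_recurrence hα N y
    push_cast
    rw [show N + 1 + 1 = N + 2 from rfl]
    generalize (gegenbauer α (N + 2)).eval x = a at *
    generalize (gegenbauer α (N + 2)).eval y = a' at *
    generalize (gegenbauer α (N + 1)).eval x = b at *
    generalize (gegenbauer α (N + 1)).eval y = b' at *
    field_simp
    linear_combination (-(a * b' - b * a')) * hs - normRatio α (N + 1) * ((N : ℝ) + 2 + α) *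
      (b' * hx - b * hy)

theorem christoffel_darboux_eq_zero {α : ℝ} (hα : -1 / 2 < α) {N : ℕ} {x y : ℝ} (hxy : x ≠ y)
    (hx : (gegenbauer α (N + 1)).eval x = 0) (hy : (gegenbauer α (N + 1)).eval y = 0) :
    ∑ j ∈ Finset.range (N + 1),
      normRatio α j * ((gegenbauer α j).eval x * (gegenbauer α j).eval y) = 0 := by
  have h := christoffel_darboux hα x y N
  rw [hx, hy, zero_mul, mul_zero, sub_zero, mul_zero] at h
  exact (mul_eq_zero.1 h).resolve_left (sub_ne_zero.2 hxy)

/-- Bessel's inequality for pairwise orthogonal vectors `j ↦ p j x`, tested on a unit vector. -/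
theorem sum_sq_div_le_inv {ι : Type*} (S : Finset ι) (R : Finset ℕ) (μ : ℕ → ℝ) (p : ℕ → ι → ℝ)
    (hμ : ∀ j, 0 < μ j)
    (hpos : ∀ x ∈ S, 0 < ∑ j ∈ R, μ j * (p j x * p j x))
    (horth : ∀ x ∈ S, ∀ y ∈ S, x ≠ y → ∑ j ∈ R, μ j * (p j x * p j y) = 0)
    {n : ℕ} (hn : n ∈ R) :
    ∑ x ∈ S, p n x ^ 2 / ∑ j ∈ R, μ j * (p j x * p j x) ≤ (μ n)⁻¹ := by
  set K : ι → ℝ := fun x => ∑ j ∈ R, μ j * (p j x * p j x) with hK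
  set B := ∑ x ∈ S, p n x ^ 2 / K x with hB
  -- `q` is the combination of the node vectors with coefficients `p n x / K x`. By orthogonality
  -- its weighted squared norm is `B`, and its `n`-th coordinate is also `B`; keeping only that
  -- coordinate gives `μ n * B² ≤ B`.
  set q : ℕ → ℝ := fun j => ∑ x ∈ S, p n x / K x * p j x with hq
  have hqn : q n = B := Finset.sum_congr rfl fun x _ => by ring
  have hsum : ∑ j ∈ R, μ j * q j ^ 2 = B := by
    have h1 : ∀ j, μ j * q j ^ 2 =
        ∑ x ∈ S, ∑ y ∈ S, p n x / K x * (p n y / K y) * (μ j * (p j x * p j y)) := fun j => by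
      rw [hq, sq, Finset.sum_mul_sum, Finset.mul_sum]
      refine Finset.sum_congr rfl fun x _ => ?_
      rw [Finset.mul_sum]
      exact Finset.sum_congr rfl fun y _ => by ring
    simp_rw [h1]
    rw [Finset.sum_comm]
    refine Finset.sum_congr rfl fun x hx => ?_
    rw [Finset.sum_comm]
    simp_rw [← Finset.mul_sum]
    rw [Finset.sum_eq_single_of_mem x hx fun y hy hyx => by
      rw [horth x hx y hy hyx.symm, mul_zero]]
    have hKx : K x ≠ 0 := (hpos x hx).ne'
    change p n x / K x * (p n x / K x) * K x = _
    field_simp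
  have hle : μ n * B ^ 2 ≤ B := by
    rw [← hqn]
    conv_rhs => rw [hqn, ← hsum]
    exact Finset.single_le_sum (f := fun j => μ j * q j ^ 2)
      (fun j _ => mul_nonneg (hμ j).le (sq_nonneg _)) hn
  have hB0 : 0 ≤ B := Finset.sum_nonneg fun x hx => div_nonneg (sq_nonneg _) (hpos x hx).le
  rcases hB0.eq_or_lt with h | h
  · rw [← h]; exact (inv_pos.2 (hμ n)).le
  · rw [← one_div, le_div_iff₀ (hμ n)]
    exact le_of_mul_le_mul_right (by linarith) h

/-! ### Nodes, Christoffel numbers and the discrete `L¹` norm -/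

theorem gegenbauer_eval_of_mem_sggNodes {α L : ℝ} {N : ℕ} {x : ℝ} (hx : x ∈ sggNodes α L N) :
    (gegenbauer α (N + 1)).eval (2 / L * x - 1) = 0 := by
  rw [sggNodes, Multiset.mem_toFinset] at hx
  rw [← shiftedGegenbauer_eval]
  exact (mem_roots'.1 hx).2

theorem abs_le_one_of_mem_sggNodes {α L : ℝ} (hα : -1 / 2 < α) {N : ℕ} {x : ℝ}
    (hx : x ∈ sggNodes α L N) : |2 / L * x - 1| ≤ 1 :=
  (abs_lt_one_of_gegenbauer_eval_eq_zero hα (gegenbauer_eval_of_mem_sggNodes hx)).le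

theorem mem_Icc_of_mem_sggNodes {α L : ℝ} (hα : -1 / 2 < α) (hL : 0 < L) {N : ℕ} {x : ℝ}
    (hx : x ∈ sggNodes α L N) : x ∈ Set.Icc 0 L := by
  have h := abs_le.1 (abs_le_one_of_mem_sggNodes hα hx)
  have e : x = L / 2 * (2 / L * x) := by field_simp
  rw [e]
  exact ⟨mul_nonneg (by linarith) (by linarith [h.1]), by nlinarith [h.2]⟩

theorem christoffel_kernel_pos {α L : ℝ} (hα : -1 / 2 < α) (hL : 0 < L) (N : ℕ) (x : ℝ) :
    0 < ∑ j ∈ Finset.range (N + 1), (shiftedNormSq α L j)⁻¹ *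
      ((shiftedGegenbauer α L j).eval x * (shiftedGegenbauer α L j).eval x) := by
  have h : ∀ j, 0 < (shiftedNormSq α L j)⁻¹ := fun j => inv_pos.2 (shiftedNormSq_pos hα hL j)
  refine Finset.sum_pos' (fun j _ => mul_nonneg (h j).le (mul_self_nonneg _))
    ⟨0, by simp, ?_⟩
  simpa [shiftedGegenbauer_eval, gegenbauer_zero] using shiftedNormSq_pos hα hL 0

theorem christoffel_pos {α L : ℝ} (hα : -1 / 2 < α) (hL : 0 < L) (N : ℕ) (x : ℝ) :
    0 < christoffel α L N x := by
  simpa only [christoffel, sq, inv_pos] using christoffel_kernel_pos hα hL N x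

/-- A Christoffel number is the inverse squared length of the node's vector of values, and distinct
nodes give orthogonal vectors, so Bessel's inequality applies. -/
theorem sum_christoffel_mul_sq_le {α L : ℝ} (hα : -1 / 2 < α) (hL : 0 < L) {N n : ℕ}
    (hn : n ≤ N) :
    ∑ x ∈ sggNodes α L N, christoffel α L N x * (shiftedGegenbauer α L n).eval x ^ 2 ≤
      shiftedNormSq α L n := by
  have h := sum_sq_div_le_inv (sggNodes α L N) (Finset.range (N + 1))
    (fun j => (shiftedNormSq α L j)⁻¹) (fun j x => (shiftedGegenbauer α L j).eval x)
    (fun j => inv_pos.2 (shiftedNormSq_pos hα hL j))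
    (fun x _ => christoffel_kernel_pos hα hL N x) (fun x hx y hy hxy => ?_)
    (n := n) (by simpa using Nat.lt_succ_of_le hn)
  · rw [inv_inv] at h
    refine le_of_eq_of_le (Finset.sum_congr rfl fun x _ => ?_) h
    rw [div_eq_inv_mul, christoffel]
    simp only [sq]
  · have hne : 2 / L * x - 1 ≠ 2 / L * y - 1 := fun h => hxy <|
      mul_left_cancel₀ (div_pos two_pos hL).ne' (sub_left_inj.1 h)
    have h := christoffel_darboux_eq_zero hα hne (gegenbauer_eval_of_mem_sggNodes hx)
      (gegenbauer_eval_of_mem_sggNodes hy)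
    rw [← mul_zero (shiftedNormSq α L 0)⁻¹, ← h, Finset.mul_sum]
    refine Finset.sum_congr rfl fun j _ => ?_
    rw [shiftedNormSq_inv hα hL j, shiftedGegenbauer_eval, shiftedGegenbauer_eval, mul_assoc]

theorem sum_christoffel_le {α L : ℝ} (hα : -1 / 2 < α) (hL : 0 < L) (N : ℕ) :
    ∑ x ∈ sggNodes α L N, christoffel α L N x ≤ shiftedNormSq α L 0 := by
  simpa [shiftedGegenbauer_eval, gegenbauer_zero] using
    sum_christoffel_mul_sq_le hα hL (Nat.zero_le N)

/-- The discrete `L¹` norm of the shifted Gegenbauer polynomial, divided by its squared norm. -/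
noncomputable def discreteL1 (α L : ℝ) (N n : ℕ) : ℝ :=
  (shiftedNormSq α L n)⁻¹ *
    ∑ x ∈ sggNodes α L N, christoffel α L N x * |(shiftedGegenbauer α L n).eval x|

theorem discreteL1_nonneg {α L : ℝ} (hα : -1 / 2 < α) (hL : 0 < L) (N n : ℕ) :
    0 ≤ discreteL1 α L N n :=
  mul_nonneg (inv_pos.2 (shiftedNormSq_pos hα hL n)).le <|
    Finset.sum_nonneg fun x _ => mul_nonneg (christoffel_pos hα hL N x).le (abs_nonneg _)

/-- Cauchy-Schwarz with weights `ϖ`: the squared sum is at most `λ_0 λ_n`, and division by `λ_n²`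
leaves `λ_0/λ_n`. -/
theorem discreteL1_le_sqrt {α L : ℝ} (hα : -1 / 2 < α) (hL : 0 < L) {N n : ℕ} (hn : n ≤ N) :
    discreteL1 α L N n ≤ √(normRatio α n) := by
  have hpos := shiftedNormSq_pos hα hL n
  have hw := fun x => (christoffel_pos hα hL N x).le
  refine Real.le_sqrt_of_sq_le ?_
  have h := Finset.sum_sq_le_sum_mul_sum_of_sq_le_mul (sggNodes α L N)
    (r := fun x => christoffel α L N x * |(shiftedGegenbauer α L n).eval x|)
    (f := fun x => christoffel α L N x)
    (g := fun x => christoffel α L N x * (shiftedGegenbauer α L n).eval x ^ 2)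
    (fun x _ => hw x) (fun x _ => mul_nonneg (hw x) (sq_nonneg _))
    (fun x _ => by rw [mul_pow, sq_abs, sq, mul_assoc])
  have h2 := h.trans (mul_le_mul (sum_christoffel_le hα hL N) (sum_christoffel_mul_sq_le hα hL hn)
    (Finset.sum_nonneg fun x _ => mul_nonneg (hw x) (sq_nonneg _))
    (shiftedNormSq_pos hα hL 0).le)
  rw [← shiftedNormSq_mul_normRatio hα hL n] at h2
  rw [discreteL1, mul_pow, inv_pow, inv_mul_le_iff₀ (by positivity)]
  linarith

theorem discreteL1_le_normRatio_mul {α L : ℝ} (hα : -1 / 2 < α) (hL : 0 < L) {N n : ℕ} {M : ℝ}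
    (hM : ∀ x, |x| ≤ 1 → |(gegenbauer α n).eval x| ≤ M) :
    discreteL1 α L N n ≤ normRatio α n * M := by
  have hpos := shiftedNormSq_pos hα hL n
  have hM0 : 0 ≤ M := (abs_nonneg _).trans (hM 0 (by simp))
  rw [discreteL1, inv_mul_le_iff₀ hpos, ← mul_assoc, shiftedNormSq_mul_normRatio hα hL]
  refine le_trans (Finset.sum_le_sum fun x hx => ?_)
    (le_of_eq_of_le (Finset.sum_mul _ _ M).symm
      (mul_le_mul_of_nonneg_right (sum_christoffel_le hα hL N) hM0))
  rw [shiftedGegenbauer_eval]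
  exact mul_le_mul_of_nonneg_left (hM _ (abs_le_one_of_mem_sggNodes hα hx))
    (christoffel_pos hα hL N x).le

theorem abs_discreteCoeff_le {α l τ : ℝ} (hα : -1 / 2 < α) (hl : 0 < l) (hτ : 0 < τ)
    (Nx Nt n m : ℕ) {φ : ℝ → ℝ → ℝ} {M : ℝ}
    (hφ : ∀ x ∈ Set.Icc 0 l, ∀ t ∈ Set.Icc 0 τ, |φ x t| ≤ M) :
    |discreteCoeff α l τ Nx Nt φ n m| ≤ M * (discreteL1 α l Nx n * discreteL1 α τ Nt m) := by
  have hn := shiftedNormSq_pos hα hl n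
  have hm := shiftedNormSq_pos hα hτ m
  have key : |∑ x ∈ sggNodes α l Nx, ∑ t ∈ sggNodes α τ Nt,
      (christoffel α l Nx x * christoffel α τ Nt t) * φ x t *
        ((shiftedGegenbauer α l n).eval x * (shiftedGegenbauer α τ m).eval t)| ≤
      M * ((∑ x ∈ sggNodes α l Nx, christoffel α l Nx x * |(shiftedGegenbauer α l n).eval x|) *
        ∑ t ∈ sggNodes α τ Nt, christoffel α τ Nt t * |(shiftedGegenbauer α τ m).eval t|) := by
    rw [Finset.sum_mul_sum, Finset.mul_sum]
    refine (Finset.abs_sum_le_sum_abs _ _).trans (Finset.sum_le_sum fun x hx => ?_)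
    rw [Finset.mul_sum]
    refine (Finset.abs_sum_le_sum_abs _ _).trans (Finset.sum_le_sum fun t ht => ?_)
    have hx' := (christoffel_pos hα hl Nx x).le
    have ht' := (christoffel_pos hα hτ Nt t).le
    have h := hφ x (mem_Icc_of_mem_sggNodes hα hl hx) t (mem_Icc_of_mem_sggNodes hα hτ ht)
    rw [abs_mul, abs_mul, abs_mul, abs_mul, abs_of_nonneg hx', abs_of_nonneg ht']
    have := mul_le_mul_of_nonneg_right h (show 0 ≤ christoffel α l Nx x * christoffel α τ Nt t *
      (|(shiftedGegenbauer α l n).eval x| * |(shiftedGegenbauer α τ m).eval t|) by positivity)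
    linarith
  rw [discreteCoeff, abs_mul, abs_of_pos (by positivity)]
  refine (mul_le_mul_of_nonneg_left key (by positivity)).trans_eq ?_
  simp only [discreteL1]
  field_simp

/-! ### Values at the origin and the bounds for negative `α` -/

theorem succ_mul_multichoose (α : ℝ) (k : ℕ) :
    ((k : ℝ) + 1) * Ring.multichoose α (k + 1) = (α + k) * Ring.multichoose α k := by
  have h0 := Ring.factorial_nsmul_multichoose_eq_ascPochhammer α k
  have h1 := Ring.factorial_nsmul_multichoose_eq_ascPochhammer α (k + 1)
  rw [ascPochhammer_succ_right, smeval_mul, ← h0, smeval_add, smeval_X, smeval_natCast] at h1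
  simp only [nsmul_eq_mul, Nat.factorial_succ, pow_one, pow_zero, mul_one] at h1
  push_cast at h1
  have : (k.factorial : ℝ) ≠ 0 := by positivity
  refine mul_left_cancel₀ this ?_
  linear_combination h1

theorem absHalfChoose_two_mul (α : ℝ) (k : ℕ) :
    absHalfChoose α (2 * k) = |Ring.multichoose α k| := by
  rw [absHalfChoose, Ring.multichoose_eq, Nat.mul_div_cancel_left k two_pos]
  congr 2
  push_cast
  ring

theorem normRatio_succ_of_all {α : ℝ} (hα : -1 / 2 < α) (n : ℕ) :
    ((n : ℝ) + 1) * (n + α) * normRatio α (n + 1) =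
      ((n : ℝ) + 1 + α) * (n + 2 * α) * normRatio α n := by
  cases n with
  | zero => rw [normRatio_zero hα, normRatio_one hα]; push_cast; ring
  | succ n =>
    push_cast
    linear_combination normRatio_succ hα n

theorem two_mul_add_ne_zero {α : ℝ} (hα : -1 / 2 < α) (hα0 : α ≠ 0) (k : ℕ) :
    2 * (k : ℝ) + α ≠ 0 := by
  cases k with
  | zero => simpa using hα0
  | succ k =>
    have : (0 : ℝ) ≤ k := k.cast_nonneg
    push_cast
    linarith

/-- At `x = 0` the recurrence links only `C_{2k+2}` and `C_{2k}`; combined with two steps of the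
norm ratio it becomes the recurrence of `(α)_k / k!`. The factors `α` and `(-1)^k` on the left avoid
division and remove the sign. -/
theorem normRatio_mul_gegenbauer_eval_zero {α : ℝ} (hα : -1 / 2 < α) (hα0 : α ≠ 0) (k : ℕ) :
    normRatio α (2 * k) * (gegenbauer α (2 * k)).eval 0 * (-1) ^ k * α =
      (2 * k + α) * Ring.multichoose α k := by
  induction k with
  | zero => simp [normRatio_zero hα, gegenbauer_zero]
  | succ k ih =>
    have h1 := normRatio_succ_of_all hα (2 * k)
    have h2 := normRatio_succ_of_all hα (2 * k + 1)
    have hg := gegenbauer_eval_recurrence hα (2 * k) 0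
    have hc := succ_mul_multichoose α k
    have hk : (0 : ℝ) ≤ k := k.cast_nonneg
    have hne := two_mul_add_ne_zero hα hα0 k
    have hne1 : 2 * (k : ℝ) + 1 + α ≠ 0 := by linarith
    have hne2 : 2 * (k : ℝ) + 2 ≠ 0 := by linarith
    have hP : (2 * (k : ℝ) + 2) * (2 * k + 1 + α) * (2 * k + α) ≠ 0 :=
      mul_ne_zero (mul_ne_zero hne2 hne1) hne
    refine mul_left_cancel₀ hP ?_
    rw [show 2 * (k + 1) = 2 * k + 2 by ring, pow_succ]
    rw [show 2 * k + 1 + 1 = 2 * k + 2 from rfl] at h2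
    push_cast at h1 h2 hg ⊢
    generalize (gegenbauer α (2 * k + 2)).eval 0 = g2 at *
    generalize (gegenbauer α (2 * k)).eval 0 = g at *
    generalize normRatio α (2 * k + 2) = s2 at *
    generalize normRatio α (2 * k + 1) = s1 at *
    generalize normRatio α (2 * k) = s at *
    generalize (-1 : ℝ) ^ k = e at *
    linear_combination (-e * α * (2 * k + α) * g2) * h2
      - e * α * (2 * k + α) * (2 * k + 2 + α) * s1 * hg
      + e * α * (2 * k + 2 + α) * g * h1
      + (2 * k + 2 + α) * (2 * k + 1 + α) * (2 * k + 2 * α) * ih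
      - 2 * (2 * k + 2 + α) * (2 * k + 1 + α) * (2 * k + α) * hc

theorem add_mul_multichoose {α : ℝ} (hα : -1 / 2 < α) (k : ℕ) :
    (k + α) * Ring.multichoose α k * (Real.Gamma (α + 1) * Real.Gamma (k + 1)) =
      α * Real.Gamma (k + 1 + α) := by
  induction k with
  | zero => simp [add_comm]
  | succ k ih =>
    have hk : (0 : ℝ) ≤ k := k.cast_nonneg
    have g1 : Real.Gamma ((k : ℝ) + 1 + 1) = (k + 1) * Real.Gamma (k + 1) :=
      Real.Gamma_add_one (by linarith)
    have g2 : Real.Gamma ((k : ℝ) + 1 + 1 + α) = (k + 1 + α) * Real.Gamma (k + 1 + α) := by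
      rw [← Real.Gamma_add_one (by linarith)]; ring_nf
    push_cast
    rw [g1, g2]
    linear_combination (k + 1 + α) * ih + (k + 1 + α) * Real.Gamma (α + 1) *
      Real.Gamma (k + 1) * succ_mul_multichoose α k

theorem gegenbauer_odd_eval_zero {α : ℝ} (hα : -1 / 2 < α) (k : ℕ) :
    (gegenbauer α (2 * k + 1)).eval 0 = 0 := by
  have h := gegenbauer_eval_neg hα 0 (2 * k + 1)
  rw [neg_zero, pow_succ, pow_mul] at h
  norm_num at h
  linarith

theorem derivative_gegenbauer_eval_zero {α : ℝ} (hα : -1 / 2 < α) (n : ℕ) :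
    (derivative (gegenbauer α (n + 1))).eval 0 = ((n : ℝ) + 1) * (gegenbauer α n).eval 0 := by
  simpa using congrArg (eval 0) (one_sub_sq_mul_derivative_gegenbauer hα n).1

/-- An even polynomial has zero derivative at the origin, so Sonin's inequality reads `C_n(x)² ≤
C_n(0)²` after division by `n(n+2α)`; this factor vanishes at `n = 0`, which is treated apart. -/
theorem abs_gegenbauer_even_le {α : ℝ} (hα : -1 / 2 < α) (hα0 : α ≤ 0) (k : ℕ) {x : ℝ}
    (hx : |x| ≤ 1) : |(gegenbauer α (2 * k)).eval x| ≤ |(gegenbauer α (2 * k)).eval 0| := by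
  cases k with
  | zero => simp [gegenbauer_zero]
  | succ k =>
    have h := gegenbauer_sonin hα hα0 (2 * k + 2) hx
    have hd := derivative_gegenbauer_eval_zero hα (2 * k + 1)
    rw [gegenbauer_odd_eval_zero hα, mul_zero] at hd
    rw [hd, zero_pow two_ne_zero, add_zero] at h
    have hk : (0 : ℝ) ≤ k := k.cast_nonneg
    push_cast at h
    exact sq_le_sq.1 (le_of_mul_le_mul_left h (mul_pos (by linarith) (by linarith)))

/-- In the odd case only the derivative term survives at the origin, and it equals `(2k+1)
C_{2k}(0)`. -/
theorem abs_gegenbauer_odd_le {α : ℝ} (hα : -1 / 2 < α) (hα0 : α ≤ 0) (k : ℕ) {x : ℝ}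
    (hx : |x| ≤ 1) : |(gegenbauer α (2 * k + 1)).eval x| ≤
      (2 * k + 1) * |(gegenbauer α (2 * k)).eval 0| / √((2 * k + 1) * (2 * k + 1 + 2 * α)) := by
  have h := gegenbauer_sonin hα hα0 (2 * k + 1) hx
  have hk : (0 : ℝ) ≤ k := k.cast_nonneg
  have hq : 0 < (2 * (k : ℝ) + 1) * (2 * k + 1 + 2 * α) := mul_pos (by linarith) (by linarith)
  rw [derivative_gegenbauer_eval_zero hα, gegenbauer_odd_eval_zero hα] at h
  push_cast at h
  rw [le_div_iff₀ (Real.sqrt_pos.2 hq)]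
  refine abs_le_of_sq_le_sq' ?_ (by positivity) |>.2
  rw [mul_pow, mul_pow, sq_abs, sq_abs, Real.sq_sqrt hq.le]
  linarith

theorem discreteL1_le_of_even {α L : ℝ} (hα : -1 / 2 < α) (hα0 : α < 0) (hL : 0 < L) {N n : ℕ}
    (hn : Even n) : discreteL1 α L N n ≤ |n + α| / |α| * absHalfChoose α n := by
  obtain ⟨k, rfl⟩ := hn.two_dvd
  refine (discreteL1_le_normRatio_mul hα hL fun x => abs_gegenbauer_even_le hα hα0.le k).trans_eq ?_
  have h := congrArg abs (normRatio_mul_gegenbauer_eval_zero hα hα0.ne k)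
  simp only [abs_mul, abs_pow, abs_neg, abs_one, one_pow, mul_one,
    abs_of_pos (normRatio_pos hα _)] at h
  have : |α| ≠ 0 := abs_ne_zero.2 hα0.ne
  rw [absHalfChoose_two_mul]
  push_cast
  field_simp
  exact h

theorem discreteL1_le_of_odd {α L : ℝ} (hα : -1 / 2 < α) (hα0 : α < 0) (hL : 0 < L) {N n : ℕ}
    (hn : Odd n) : discreteL1 α L N n ≤
      2 * |n + α| * Real.Gamma (((n : ℝ) + 1) / 2 + α) /
        (Real.Gamma (α + 1) * Real.Gamma (((n : ℝ) + 1) / 2) * √(n * (n + 2 * α))) := by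
  obtain ⟨k, rfl⟩ := hn
  refine (discreteL1_le_normRatio_mul hα hL fun x => abs_gegenbauer_odd_le hα hα0.le k).trans_eq ?_
  have hk : (0 : ℝ) ≤ k := k.cast_nonneg
  have h1 := normRatio_succ_of_all hα (2 * k)
  have h2 := normRatio_mul_gegenbauer_eval_zero hα hα0.ne k
  have h3 := add_mul_multichoose hα k
  have hne := two_mul_add_ne_zero hα hα0.ne k
  have hG : 0 < Real.Gamma (α + 1) := Real.Gamma_pos_of_pos (by linarith)
  have hGk : 0 < Real.Gamma ((k : ℝ) + 1) := Real.Gamma_pos_of_pos (by linarith)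
  have hGa : 0 < Real.Gamma ((k : ℝ) + 1 + α) := Real.Gamma_pos_of_pos (by linarith)
  have hpos : 0 < 2 * (k : ℝ) + 1 + α := by linarith
  have hq : 0 < √((2 * (k : ℝ) + 1) * (2 * k + 1 + 2 * α)) :=
    Real.sqrt_pos.2 (mul_pos (by linarith) (by linarith))
  push_cast at h1
  -- One step of the norm ratio reduces the odd index to `2k`, where the value at the origin is
  -- known; `add_mul_multichoose` then turns the binomial coefficient into Gamma values.
  have key : (2 * k + 1) * normRatio α (2 * k + 1) * (gegenbauer α (2 * k)).eval 0 * (-1) ^ k *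
      (Real.Gamma (α + 1) * Real.Gamma (k + 1)) =
      2 * (2 * k + 1 + α) * Real.Gamma (k + 1 + α) := by
    refine mul_left_cancel₀ (mul_ne_zero hα0.ne hne) ?_
    linear_combination (gegenbauer α (2 * k)).eval 0 * (-1) ^ k * α *
        (Real.Gamma (α + 1) * Real.Gamma (k + 1)) * h1 +
      (2 * k + 1 + α) * (2 * k + 2 * α) * (Real.Gamma (α + 1) * Real.Gamma (k + 1)) * h2 +
      2 * (2 * k + 1 + α) * (2 * k + α) * h3
  have h := congrArg abs key
  have hk1 : (0 : ℝ) < 2 * k + 1 := by linarith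
  simp only [abs_mul, abs_pow, abs_neg, abs_one, one_pow, mul_one, abs_of_pos hk1, abs_of_pos hG,
    abs_of_pos hGk, abs_of_pos hGa, abs_of_pos hpos, abs_of_pos (normRatio_pos hα _),
    abs_two] at h
  have e : ((2 * (k : ℝ) + 1) + 1) / 2 = k + 1 := by ring
  push_cast
  rw [e, abs_of_pos hpos]
  field_simp
  linear_combination h

/-! ### Growth of the norm ratio and the constant `D₁` -/

/-- The two extra linear factors complete the product to the denominator of `Real.GammaSeq (2α+1)
(n+1)`, whose limit then controls the growth. -/
theorem normRatio_mul_eq_prod {α : ℝ} (hα : -1 / 2 < α) (n : ℕ) :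
    normRatio α (n + 1) * ((n + 1 + 2 * α) * (n + 2 + 2 * α)) * ((n + 1).factorial : ℝ) =
      2 * (n + 1 + α) * ∏ j ∈ Finset.range (n + 1 + 1), (2 * α + 1 + (j : ℝ)) := by
  induction n with
  | zero =>
    simp only [zero_add, normRatio_one hα, Finset.prod_range_succ, Finset.prod_range_zero,
      CharP.cast_eq_zero, Nat.cast_one, Nat.factorial_one]
    ring
  | succ n ih =>
    rw [Finset.prod_range_succ, Nat.factorial_succ]
    have h := normRatio_succ hα n
    have hne := index_pos hα n
    refine mul_left_cancel₀ hne.ne' ?_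
    push_cast
    rw [show n + 1 + 1 = n + 2 from rfl] at *
    linear_combination (n + 2 + α) * (n + 3 + 2 * α) * ih + (n + 2 + 2 * α) * (n + 3 + 2 * α) *
      ((n + 1).factorial : ℝ) * h

theorem normRatio_le_rpow {α : ℝ} (hα : -1 / 2 < α) :
    ∃ c : ℝ, 0 < c ∧ ∀ᶠ n : ℕ in Filter.atTop, normRatio α n ≤ c * (n : ℝ) ^ (2 * α) := by
  have hG : 0 < Real.Gamma (2 * α + 1) := Real.Gamma_pos_of_pos (by linarith)
  have hlim := Real.GammaSeq_tendsto_Gamma (2 * α + 1)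
  -- The constant `16` is `2 · 2 · 2 · 2`: the factor `2` in the norm ratio, the losses in `hden`
  -- and `hnum`, and the replacement of the Gamma limit by half of it.
  refine ⟨16 / Real.Gamma (2 * α + 1), by positivity, ?_⟩
  filter_upwards [hlim.eventually_const_lt (half_lt_self hG), Filter.eventually_ge_atTop 1,
    (tendsto_natCast_atTop_atTop (R := ℝ)).eventually_ge_atTop (|α|),
    (tendsto_natCast_atTop_atTop (R := ℝ)).eventually_ge_atTop 2] with n hn h1 hα' h2
  obtain ⟨k, rfl⟩ : ∃ k, n = k + 1 := ⟨n - 1, by omega⟩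
  have hprod : 0 < ∏ j ∈ Finset.range (k + 1 + 1), (2 * α + 1 + (j : ℝ)) :=
    Finset.prod_pos fun j _ => by
      have : (0 : ℝ) ≤ j := j.cast_nonneg
      linarith
  have hkey := normRatio_mul_eq_prod hα k
  rw [Real.GammaSeq, lt_div_iff₀ hprod, Real.rpow_add_one (by positivity)] at hn
  set P := ∏ j ∈ Finset.range (k + 1 + 1), (2 * α + 1 + (j : ℝ))
  set R := ((k + 1 : ℕ) : ℝ) ^ (2 * α)
  have hR : 0 < R := Real.rpow_pos_of_pos (by positivity) _
  have hF : (0 : ℝ) < ((k + 1).factorial : ℝ) := by positivity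
  push_cast at hn hα' h2
  have hk1 : (0 : ℝ) < (k : ℝ) + 1 := by positivity
  have hden : ((k : ℝ) + 1) * (k + 1) ≤ 2 * ((k + 1 + 2 * α) * (k + 2 + 2 * α)) := by
    nlinarith [mul_nonneg (by linarith : (0 : ℝ) ≤ 2 * α + 1) hk1.le, sq_nonneg (2 * α + 1)]
  have hnum : (k : ℝ) + 1 + α ≤ 2 * (k + 1) := by linarith [le_abs_self α]
  have hnum0 : 0 < (k : ℝ) + 1 + α := index_pos hα k
  set s := normRatio α (k + 1)
  have hs : 0 < s := normRatio_pos hα _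
  rw [div_mul_eq_mul_div, le_div_iff₀ hG]
  have e1 : s * ((k + 1) * (k + 1)) * ((k + 1).factorial : ℝ) ≤ 8 * (k + 1) * P := by
    calc s * ((k + 1) * (k + 1)) * ((k + 1).factorial : ℝ)
        ≤ s * (2 * ((k + 1 + 2 * α) * (k + 2 + 2 * α))) * ((k + 1).factorial : ℝ) := by gcongr
      _ = 4 * (k + 1 + α) * P := by linear_combination 2 * hkey
      _ ≤ 4 * (2 * (k + 1)) * P := by gcongr
      _ = _ := by ring
  refine le_of_mul_le_mul_right (a := P * ((k + 1) * (k + 1)) * ((k + 1).factorial : ℝ)) ?_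
    (by positivity)
  calc s * Real.Gamma (2 * α + 1) * (P * ((k + 1) * (k + 1)) * ((k + 1).factorial : ℝ))
      = 2 * (s * ((k + 1) * (k + 1)) * ((k + 1).factorial : ℝ)) *
        (Real.Gamma (2 * α + 1) / 2 * P) := by ring
    _ ≤ 2 * (8 * (k + 1) * P) * (R * (k + 1) * ((k + 1).factorial : ℝ)) := by gcongr
    _ = _ := by ring

theorem D₁_pos {α : ℝ} (hα : -1 / 2 < α) : 0 < D₁ α := by
  have h1 := Real.Gamma_pos_of_pos (show 0 < α + 1 / 2 by linarith)
  have h2 := Real.Gamma_pos_of_pos (show 0 < α + 1 by linarith)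
  have h3 := Real.pi_pos
  rw [D₁]
  positivity

/-- At `α = 0` no power of `n` can absorb a constant, so the numerical value `D₁ 0 = 8π/e²` has to
dominate the bound `2` for the norm ratio. -/
theorem two_le_D₁_zero : 2 ≤ D₁ 0 := by
  have hpi := Real.pi_gt_three
  have he : Real.exp 2 < 9 := by
    have h := Real.exp_one_lt_d9
    have e : Real.exp 2 = Real.exp 1 ^ 2 := by rw [← Real.exp_nat_mul]; norm_num
    rw [e]
    nlinarith [Real.exp_pos 1]
  have e : D₁ 0 = 8 * Real.pi / Real.exp 2 := by
    have h8 : (2 : ℝ) ^ (3 - 4 * (0 : ℝ)) = 8 := by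
      rw [mul_zero, sub_zero, show (3 : ℝ) = ((3 : ℕ) : ℝ) by norm_num, Real.rpow_natCast]
      norm_num
    have he2 : Real.exp (-4 * 0 - 2) = (Real.exp 2)⁻¹ := by rw [← Real.exp_neg]; norm_num
    rw [D₁, h8, he2, zero_add, zero_add, Real.Gamma_one, Real.Gamma_one_half_eq,
      Real.sq_sqrt Real.pi_pos.le]
    field_simp
  rw [e, le_div_iff₀ (Real.exp_pos 2)]
  linarith

theorem sqrt_normRatio_le_rpow {α : ℝ} (hα : -1 / 2 < α) :
    ∃ c : ℝ, 0 < c ∧ ∀ᶠ n : ℕ in Filter.atTop, √(normRatio α n) ≤ c * (n : ℝ) ^ α := by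
  obtain ⟨c, hc, h⟩ := normRatio_le_rpow hα
  refine ⟨√c, Real.sqrt_pos.2 hc, h.mono fun n hn => ?_⟩
  have hn0 : (0 : ℝ) ≤ n := n.cast_nonneg
  refine (Real.sqrt_le_sqrt hn).trans_eq ?_
  rw [Real.sqrt_mul hc.le, mul_comm 2 α, Real.rpow_mul hn0, Real.rpow_two,
    Real.sqrt_sq (Real.rpow_nonneg hn0 _)]

theorem normRatio_zero_parameter (n : ℕ) : normRatio 0 n ≤ 2 := by
  cases n with
  | zero => rw [normRatio_zero (by norm_num)]; norm_num
  | succ n =>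
    have h : Real.Gamma ((n : ℝ) + 2) = (n + 1) * Real.Gamma (n + 1) := by
      rw [← Real.Gamma_add_one (by positivity)]; ring_nf
    have hG : Real.Gamma ((n : ℝ) + 1) ≠ 0 := (Real.Gamma_pos_of_pos (by positivity)).ne'
    have hn : (n : ℝ) + 1 ≠ 0 := by positivity
    rw [normRatio_succ_eq, h]
    simp only [mul_zero, add_zero, zero_add, Real.Gamma_one, one_mul]
    rw [mul_div_assoc, div_self (mul_ne_zero hn hG), mul_one]

/-- For `α > 0` the left side is `O((nm)^α)` while the right side grows like `(nm)^(2α)`, so any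
positive constant works for large indices; `α = 0` is settled numerically. -/
theorem eventually_sqrt_normRatio_mul_le {α : ℝ} (hα : 0 ≤ α) :
    ∃ n₀ : ℕ, ∀ n m, n₀ ≤ n → n₀ ≤ m →
      √(normRatio α n) * √(normRatio α m) ≤ D₁ α * ((n : ℝ) * m) ^ (2 * α) := by
  have hα' : -1 / 2 < α := by linarith
  rcases hα.eq_or_lt with rfl | hpos
  · refine ⟨0, fun n m _ _ => ?_⟩
    rw [mul_zero, Real.rpow_zero, mul_one]
    refine le_trans ?_ two_le_D₁_zero
    calc √(normRatio 0 n) * √(normRatio 0 m) ≤ √2 * √2 := by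
          gcongr <;> exact normRatio_zero_parameter _
      _ = 2 := Real.mul_self_sqrt (by norm_num)
  · obtain ⟨c, hc, h⟩ := sqrt_normRatio_le_rpow hα'
    have hD := Real.sqrt_pos.2 (D₁_pos hα')
    have hlarge := ((tendsto_rpow_atTop hpos).comp
      (tendsto_natCast_atTop_atTop (R := ℝ))).eventually_ge_atTop (c / √(D₁ α))
    obtain ⟨n₀, hn₀⟩ := Filter.eventually_atTop.1 (h.and hlarge)
    have one : ∀ n, n₀ ≤ n → √(normRatio α n) ≤ √(D₁ α) * (n : ℝ) ^ (2 * α) := fun n hn => by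
      obtain ⟨h1, h2⟩ := hn₀ n hn
      have hn0 : (0 : ℝ) ≤ n := n.cast_nonneg
      rw [Function.comp_apply, div_le_iff₀ hD] at h2
      refine h1.trans ?_
      rw [mul_comm 2 α, Real.rpow_mul hn0, Real.rpow_two, sq, ← mul_assoc]
      exact mul_le_mul_of_nonneg_right (by linarith) (Real.rpow_nonneg hn0 _)
    refine ⟨n₀, fun n m hn hm => ?_⟩
    have hn0 : (0 : ℝ) ≤ n := n.cast_nonneg
    have hm0 : (0 : ℝ) ≤ m := m.cast_nonneg
    refine (mul_le_mul (one n hn) (one m hm) (Real.sqrt_nonneg _) (by positivity)).trans_eq ?_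
    rw [Real.mul_rpow hn0 hm0]
    linear_combination ((n : ℝ) ^ (2 * α) * (m : ℝ) ^ (2 * α)) *
      Real.mul_self_sqrt (D₁_pos hα').le

theorem eventually_sqrt_normRatio_mul_le_of_neg {α : ℝ} (hα : -1 / 2 < α) :
    ∃ A₁ A₂ : ℝ, 1 < A₁ ∧ 1 < A₂ ∧ ∃ n₀ : ℕ, ∀ n m, n₀ ≤ n → n₀ ≤ m →
      √(normRatio α n) * √(normRatio α m) ≤ A₁ * A₂ * D₁ α * ((n : ℝ) * m) ^ α := by
  obtain ⟨c, hc, h⟩ := sqrt_normRatio_le_rpow hα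
  obtain ⟨n₀, hn₀⟩ := Filter.eventually_atTop.1 h
  have hD := D₁_pos hα
  -- `A₁` is chosen so that `A₁ D₁ = D₁ + c²` exceeds the required `c²`; `A₂ = 2` is any number
  -- above `1`.
  refine ⟨1 + c ^ 2 / D₁ α, 2, by linarith [show 0 < c ^ 2 / D₁ α by positivity], by norm_num, n₀,
    fun n m hn hm => ?_⟩
  have hn0 : (0 : ℝ) ≤ n := n.cast_nonneg
  have hm0 : (0 : ℝ) ≤ m := m.cast_nonneg
  refine (mul_le_mul (hn₀ n hn) (hn₀ m hm) (Real.sqrt_nonneg _) (by positivity)).trans ?_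
  rw [Real.mul_rpow hn0 hm0]
  have e : (1 + c ^ 2 / D₁ α) * 2 * D₁ α = 2 * D₁ α + 2 * c ^ 2 := by field_simp
  have hp : 0 ≤ (n : ℝ) ^ α * (m : ℝ) ^ α := by positivity
  rw [e]
  nlinarith [mul_nonneg hp hD.le, mul_nonneg hp (sq_nonneg c)]

/-! ### The bound on `u_xx` and the final assembly -/

theorem abs_uxx_le {l τ ρ C : ℝ} {u : ℝ → ℝ → ℝ} {tStar : ℝ} (hmax : IsArgmaxTime l τ u tStar)
    (hbound : ∀ x ∈ Set.Icc 0 l, |iteratedDerivWithin 2 (fun y => u y tStar) (Set.Icc 0 l) x| ≤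
      C * (Nat.factorial 2 : ℝ) / ρ ^ 2) :
    ∀ x ∈ Set.Icc 0 l, ∀ t ∈ Set.Icc 0 τ, |uxx l u x t| ≤ 2 / ρ ^ 2 * C := by
  intro x hx t ht
  have hC : ∀ y ∈ Set.Icc 0 l, |uxx l u y tStar| ≤ 2 / ρ ^ 2 * C := fun y hy =>
    (hbound y hy).trans_eq (by rw [Nat.factorial_two]; push_cast; ring)
  have hC0 : 0 ≤ 2 / ρ ^ 2 * C := (abs_nonneg _).trans (hC x hx)
  -- The suprema live in `ENNReal`, so they make sense before boundedness is known; finiteness at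
  -- `tStar` passes to all `t` by maximality.
  have h1 : ‖uxx l u x t‖ₑ ≤ ⨆ y ∈ Set.Icc 0 l, ‖uxx l u y t‖ₑ :=
    le_iSup₂ (f := fun y (_ : y ∈ Set.Icc 0 l) => ‖uxx l u y t‖ₑ) x hx
  have h2 : (⨆ y ∈ Set.Icc 0 l, ‖uxx l u y tStar‖ₑ) ≤ ENNReal.ofReal (2 / ρ ^ 2 * C) :=
    iSup₂_le fun y hy => by
      rw [Real.enorm_eq_ofReal_abs]
      exact ENNReal.ofReal_le_ofReal (hC y hy)
  have h3 := (h1.trans (hmax.2 ht)).trans h2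
  rw [Real.enorm_eq_ofReal_abs] at h3
  exact (ENNReal.ofReal_le_ofReal_iff hC0).1 h3

theorem rpow_quarter_eq {a b c d : ℝ} (ha : 0 ≤ a) (hb : 0 ≤ b) (hc : 0 ≤ c) (hd : 0 ≤ d) :
    (a ^ 2 * b ^ 2 * c ^ 2 * d ^ 2) ^ ((1 : ℝ) / 4) = √(a * c) * √(b * d) := by
  rw [← Real.sqrt_mul (by positivity), Real.sqrt_eq_rpow,
    show a ^ 2 * b ^ 2 * c ^ 2 * d ^ 2 = (a * c * (b * d)) ^ (2 : ℝ) by rw [Real.rpow_two]; ring,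
    ← Real.rpow_mul (by positivity)]
  norm_num

theorem abs_mul_abs_Gamma {α : ℝ} (hα : -1 / 2 < α) (hα0 : α ≠ 0) :
    |α| * |Real.Gamma α| = Real.Gamma (α + 1) := by
  rw [← abs_mul, ← Real.Gamma_add_one hα0]
  exact abs_of_pos (Real.Gamma_pos_of_pos (by linarith))

end TelegraphGegenbauer

theorem mainTheorem11 (α : ℝ) (hα : -1 / 2 < α) :
    ∃ A₁ A₂ : ℝ, 1 < A₁ ∧ 1 < A₂ ∧ ∃ n₀ : ℕ,
      ∀ (l τ β₁ β₂ : ℝ) (f : ℝ → ℝ → ℝ) (g₁ g₂ h₁ h₂ : ℝ → ℝ) (u : ℝ → ℝ → ℝ)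
        (tStar ρ C : ℝ),
        0 < l → 0 < τ → 1 ≤ ρ →
        IsTelegraphSolution l τ β₁ β₂ f g₁ g₂ h₁ h₂ u →
        IsArgmaxTime l τ u tStar →
        AnalyticOn ℝ (fun x => u x tStar) (Set.Icc 0 l) →
        (∀ k : ℕ, ∀ x ∈ Set.Icc 0 l,
          |iteratedDerivWithin k (fun y => u y tStar) (Set.Icc 0 l) x|
            ≤ C * (k.factorial : ℝ) / ρ ^ k) →
        ∀ Nx Nt n m : ℕ, n ≤ Nx → m ≤ Nt →
          (0 ≤ α →
            |discreteCoeff α l τ Nx Nt (uxx l u) n m| ≤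
              8 * C * gammaFactor α n * gammaFactor α m /
                (ρ ^ 2 * Real.Gamma (2 * α + 1) ^ 2 *
                  Real.Gamma ((n : ℝ) + 1) * Real.Gamma ((m : ℝ) + 1))) ∧
          (α < 0 → Even n → Even m →
            |discreteCoeff α l τ Nx Nt (uxx l u) n m| ≤
              2 * C * |((n : ℝ) + α) * ((m : ℝ) + α)| / (ρ * α) ^ 2 *
                (absHalfChoose α n * absHalfChoose α m)) ∧
          (α < 0 → Odd n → Odd m →
            |discreteCoeff α l τ Nx Nt (uxx l u) n m| ≤
              8 * C * |((n : ℝ) + α) * ((m : ℝ) + α)| *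
                Real.Gamma (((n : ℝ) + 1) / 2 + α) * Real.Gamma (((m : ℝ) + 1) / 2 + α) /
                (ρ ^ 2 * Real.Gamma (α + 1) ^ 2 *
                  Real.Gamma (((n : ℝ) + 1) / 2) * Real.Gamma (((m : ℝ) + 1) / 2) *
                  ((n : ℝ) ^ 2 * (m : ℝ) ^ 2 * ((n : ℝ) + 2 * α) ^ 2 *
                    ((m : ℝ) + 2 * α) ^ 2) ^ ((1 : ℝ) / 4))) ∧
          (α < 0 → Even n → Odd m →
            |discreteCoeff α l τ Nx Nt (uxx l u) n m| ≤
              4 * C * Real.Gamma (((m : ℝ) + 1) / 2 + α) * |((n : ℝ) + α) * ((m : ℝ) + α)| /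
                ((ρ * α) ^ 2 * Real.sqrt ((m : ℝ) * ((m : ℝ) + 2 * α)) *
                  Real.Gamma (((m : ℝ) + 1) / 2) * |Real.Gamma α|) * absHalfChoose α n) ∧
          (α < 0 → Odd n → Even m →
            |discreteCoeff α l τ Nx Nt (uxx l u) n m| ≤
              4 * C * Real.Gamma (((n : ℝ) + 1) / 2 + α) * |((n : ℝ) + α) * ((m : ℝ) + α)| /
                ((ρ * α) ^ 2 * Real.sqrt ((n : ℝ) * ((n : ℝ) + 2 * α)) *
                  Real.Gamma (((n : ℝ) + 1) / 2) * |Real.Gamma α|) * absHalfChoose α m) ∧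
          (n₀ ≤ n → n₀ ≤ m → 0 ≤ α →
            |discreteCoeff α l τ Nx Nt (uxx l u) n m| ≤
              2 / ρ ^ 2 * C * D₁ α * ((n : ℝ) * (m : ℝ)) ^ (2 * α)) ∧
          (n₀ ≤ n → n₀ ≤ m → α < 0 →
            |discreteCoeff α l τ Nx Nt (uxx l u) n m| ≤
              2 / ρ ^ 2 * C * (A₁ * A₂ * D₁ α) * ((n : ℝ) * (m : ℝ)) ^ α) := by

  obtain ⟨A₁, A₂, hA₁, hA₂, n₁, hn₁⟩ := eventually_sqrt_normRatio_mul_le_of_neg hα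
  obtain ⟨n₂, hn₂⟩ : ∃ n₂ : ℕ, 0 ≤ α → ∀ n m, n₂ ≤ n → n₂ ≤ m →
      √(normRatio α n) * √(normRatio α m) ≤ D₁ α * ((n : ℝ) * m) ^ (2 * α) := by
    by_cases h : 0 ≤ α
    · obtain ⟨n₂, hn₂⟩ := eventually_sqrt_normRatio_mul_le h
      exact ⟨n₂, fun _ => hn₂⟩
    -- For negative `α` the threshold `n₂` is irrelevant; this keeps one `n₀` for both signs.
    · exact ⟨0, fun h' => absurd h' h⟩
  refine ⟨A₁, A₂, hA₁, hA₂, max n₁ n₂, ?_⟩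
  intro l τ β₁ β₂ f g₁ g₂ h₁ h₂ u tStar ρ C hl hτ hρ _ hmax _ hbound Nx Nt n m hn hm
  have hρ0 : 0 < ρ := by linarith
  have hu := abs_uxx_le hmax (hbound 2)
  have hM : 0 ≤ 2 / ρ ^ 2 * C := (abs_nonneg _).trans
    (hu 0 (Set.left_mem_Icc.2 hl.le) 0 (Set.left_mem_Icc.2 hτ.le))
  have hcoeff := abs_discreteCoeff_le hα hl hτ Nx Nt n m hu
  have bound : ∀ {a b : ℝ}, discreteL1 α l Nx n ≤ a → discreteL1 α τ Nt m ≤ b →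
      |discreteCoeff α l τ Nx Nt (uxx l u) n m| ≤ 2 / ρ ^ 2 * C * (a * b) := fun ha hb =>
    hcoeff.trans <| mul_le_mul_of_nonneg_left
      (mul_le_mul ha hb (discreteL1_nonneg hα hτ Nt m)
        ((discreteL1_nonneg hα hl Nx n).trans ha)) hM
  have hsn := discreteL1_le_sqrt hα hl hn
  have hsm := discreteL1_le_sqrt hα hτ hm
  refine ⟨fun h0 => ?_, fun h0 en em => ?_, fun h0 on om => ?_, fun h0 en om => ?_,
    fun h0 on em => ?_, fun hn0 hm0 h0 => ?_, fun hn0 hm0 _ => ?_⟩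
  · have hle : ∀ k, √(normRatio α k) ≤ normRatio α k := fun k => by
      have h1 := one_le_normRatio h0 k
      exact Real.sqrt_le_iff.2 ⟨by linarith, by nlinarith⟩
    refine (bound (hsn.trans (hle n)) (hsm.trans (hle m))).trans_eq ?_
    simp only [normRatio, div_eq_mul_inv, mul_inv]
    ring
  · refine (bound (discreteL1_le_of_even hα h0 hl en)
      (discreteL1_le_of_even hα h0 hτ em)).trans_eq ?_
    rw [abs_mul, mul_pow, ← sq_abs α]
    simp only [div_eq_mul_inv, mul_inv]
    ring
  · refine (bound (discreteL1_le_of_odd hα h0 hl on)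
      (discreteL1_le_of_odd hα h0 hτ om)).trans_eq ?_
    have hpos : ∀ {k : ℕ}, Odd k → (0 : ℝ) ≤ k + 2 * α := fun hk => by
      have : (1 : ℝ) ≤ _ := Nat.one_le_cast.2 hk.pos
      linarith
    rw [abs_mul, rpow_quarter_eq n.cast_nonneg m.cast_nonneg (hpos on) (hpos om)]
    simp only [div_eq_mul_inv, mul_inv]
    ring
  · refine (bound (discreteL1_le_of_even hα h0 hl en)
      (discreteL1_le_of_odd hα h0 hτ om)).trans_eq ?_
    -- The even factor contributes `1/|α|` and the odd factor `1/Γ(α+1) = 1/(|α| |Γ(α)|)`; together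
    -- they produce the stated `α²` and `|Γ(α)|`.
    rw [abs_mul, mul_pow, ← sq_abs α, ← abs_mul_abs_Gamma hα h0.ne]
    simp only [div_eq_mul_inv, mul_inv]
    ring
  · refine (bound (discreteL1_le_of_odd hα h0 hl on)
      (discreteL1_le_of_even hα h0 hτ em)).trans_eq ?_
    rw [abs_mul, mul_pow, ← sq_abs α, ← abs_mul_abs_Gamma hα h0.ne]
    simp only [div_eq_mul_inv, mul_inv]
    ring
  · refine (bound hsn hsm).trans ?_
    rw [mul_assoc (2 / ρ ^ 2 * C)]
    exact mul_le_mul_of_nonneg_left (hn₂ h0 n m (le_of_max_le_right hn0)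
      (le_of_max_le_right hm0)) hM
  · refine (bound hsn hsm).trans ?_
    rw [mul_assoc (2 / ρ ^ 2 * C)]
    exact mul_le_mul_of_nonneg_left (hn₁ n m (le_of_max_le_left hn0)
      (le_of_max_le_left hm0)) hM
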